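/- Let $\mathcal{D}(\mathbb{R})$ be the space of smooth compactly supported functions $\mathbb{R}\to\mathbb{R}$ with its standard (inductive limit) locally convex topology, and let $\mathcal{D}'(\mathbb{R})$ be the vector space of distributions on $\mathbb{R}$, i.e. of continuous linear maps $\mathcal{D}(\mathbb{R})\to\mathbb{R}$. These spaces carry the following diffeologies, where $U$ denotes an open subset of some $\mathbb{R}^n$. A map $\Phi:U\to\mathcal{D}(\mathbb{R})$ is a smooth plot if $T\circ\Phi:U\to\mathbb{R}$ is smooth for every $T\in\mathcal{D}'(\mathbb{R})$. A map $P:U\to\mathcal{D}'(\mathbb{R})$ is a smooth plot if its transpose $U\times\mathcal{D}(\mathbb{R})\to\mathbb{R}$, $(u,\varphi)\mapsto\langle P(u),\varphi\rangle$, is smooth, i.e. if for every open subset $V$ of some $\mathbb{R}^m$, every smooth map $h:V\to U$ and every smooth plot $\Phi:V\to\mathcal{D}(\mathbb{R})$ the function $v\mapsto\langle P(h(v)),\Phi(v)\rangle$ is smooth on $V$. The half line $\mathbb{R}_{\geq 0}$ carries the diffeology induced from $\mathbb{R}$: a map $U\to\mathbb{R}_{\geq 0}$ is a smooth plot if it is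 smooth as a map $U\to\mathbb{R}$. Theorem. The heat kernel $K:\mathbb{R}_{\geq 0}\to\mathcal{D}'(\mathbb{R})$, given on $\varphi\in\mathcal{D}(\mathbb{R})$ by $$\langle K(t),\varphi\rangle=\begin{cases}\displaystyle\int_{-\infty}^{\infty}\frac{e^{-s^2/4t}}{\sqrt{4\pi t}}\,\varphi(s)\,ds & \text{if } t>0,\\[1ex] \varphi(0) & \text{if } t=0,\end{cases}$$ is smooth in the diffeological sense: for every smooth plot $p:U\to\mathbb{R}_{\geq 0}$, the composite $K\circ p:U\to\mathcal{D}'(\mathbb{R})$ is a smooth plot. -/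

import Mathlib

open Diffeology MeasureTheory
open scoped ContDiff NNReal Distributions

noncomputable section

namespace HeatDiffeology

/-- The diffeology on `X` induced by a map `f : X → Y` into a diffeological space: a map into `X` is
a plot iff its composite with `f` is a plot of `Y`. For the inclusion of a subset this is the subset
diffeology. -/
@[reducible]
def inducedDiffeology {X Y : Type*} [DiffeologicalSpace Y] (f : X → Y) : DiffeologicalSpace X where
  plots n := {p | IsPlot (f ∘ p)}
  constant_plots x := isPlot_const (x := f x)
  plot_reparam hp hg := isPlot_reparam hp hg
  locality {n p} h := DiffeologicalSpace.locality fun x ↦ by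
    obtain ⟨u, hu, hx, H⟩ := h x
    exact ⟨u, hu, hx, fun hg hg' ↦ H hg hg'⟩

/-- The product diffeology: a map into `X × Y` is a plot iff both of its components are plots. -/
instance prodDiffeology {X Y : Type*} [DiffeologicalSpace X] [DiffeologicalSpace Y] :
    DiffeologicalSpace (X × Y) where
  plots n := {p | IsPlot (fun s ↦ (p s).1) ∧ IsPlot (fun s ↦ (p s).2)}
  constant_plots x := ⟨isPlot_const (x := x.1), isPlot_const (x := x.2)⟩
  plot_reparam hp hg := ⟨isPlot_reparam hp.1 hg, isPlot_reparam hp.2 hg⟩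
  locality {n p} h :=
    ⟨DiffeologicalSpace.locality fun x ↦ by
      obtain ⟨u, hu, hx, H⟩ := h x
      exact ⟨u, hu, hx, fun hg hg' ↦ (H hg hg').1⟩,
    DiffeologicalSpace.locality fun x ↦ by
      obtain ⟨u, hu, hx, H⟩ := h x
      exact ⟨u, hu, hx, fun hg hg' ↦ (H hg hg').2⟩⟩

/-- The type of smooth maps between two diffeological spaces. -/
def SmoothMap (X Y : Type*) [DiffeologicalSpace X] [DiffeologicalSpace Y] : Type _ :=
  {f : X → Y // DSmooth f}

/-- The functional diffeology on the set of smooth maps `X → Y` (the exponential `Y ^ X` of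
diffeological spaces): a map `p : U → Y ^ X` is a plot iff its transpose `U × X → Y`,
`(u, x) ↦ p u x`, is smooth. -/
instance functionalDiffeology {X Y : Type*} [DiffeologicalSpace X] [DiffeologicalSpace Y] :
    DiffeologicalSpace (SmoothMap X Y) where
  plots n := {p | DSmooth fun z : EuclideanSpace ℝ (Fin n) × X ↦ (p z.1).1 z.2}
  constant_plots f := fun m q hq ↦ f.2 m _ hq.2
  plot_reparam {n m p g} hp hg := fun k q hq ↦
    hp k (fun s ↦ (g (q s).1, (q s).2)) ⟨(hg.comp (IsPlot.contDiff hq.1)).isPlot, hq.2⟩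
  locality {n p} h := fun m q hq ↦ DiffeologicalSpace.locality fun s ↦ by
    obtain ⟨u, hu, hs, H⟩ := h (q s).1
    have hq1 : ContDiff ℝ ∞ (fun s ↦ (q s).1) := IsPlot.contDiff hq.1
    refine ⟨(fun s ↦ (q s).1) ⁻¹' u, hu.preimage hq1.continuous, hs, fun {k g} hg hg' ↦ ?_⟩
    exact H (m := k) (f := fun r ↦ (q (g r)).1) hg (hq1.comp hg') k (fun r ↦ (r, (q (g r)).2))
      ⟨isPlot_id, isPlot_reparam hq.2 hg'⟩

/-- The canonical diffeology of a real topological vector space: a map into `V` is a plot iff its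
composite with every continuous linear functional is smooth in the usual sense. -/
@[reducible]
def scalarwiseDiffeology (V : Type*) [AddCommGroup V] [Module ℝ V] [TopologicalSpace V] :
    DiffeologicalSpace V where
  plots n := {p | ∀ φ : V →L[ℝ] ℝ, ContDiff ℝ ∞ (fun s ↦ φ (p s))}
  constant_plots x := fun _ ↦ contDiff_const
  plot_reparam hp hg := fun φ ↦ (hp φ).comp hg
  locality {n p} h := fun φ ↦ IsPlot.contDiff <| DiffeologicalSpace.locality fun x ↦ by
    obtain ⟨u, hu, hx, H⟩ := h x
    exact ⟨u, hu, hx, fun hg hg' ↦ (H hg hg' φ).isPlot⟩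

/-- The closed half line carries the diffeology induced from `ℝ`. -/
instance halfLineDiffeology : DiffeologicalSpace ℝ≥0 :=
  inducedDiffeology ((↑) : ℝ≥0 → ℝ)

/-- The space `𝓓(ℝ)` of test functions on the line carries the diffeology of its standard locally
convex topology. -/
instance testFunctionDiffeology : DiffeologicalSpace 𝓓((⊤ : TopologicalSpace.Opens ℝ), ℝ) :=
  scalarwiseDiffeology _

/-- The inclusion of the space `𝓓'(ℝ)` of distributions into the diffeological space of all smooth
maps `𝓓(ℝ) → ℝ`. -/
def distributionToSmoothMap (T : 𝓓'((⊤ : TopologicalSpace.Opens ℝ), ℝ)) :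
    SmoothMap 𝓓((⊤ : TopologicalSpace.Opens ℝ), ℝ) ℝ :=
  ⟨fun φ ↦ T φ, fun _ _ hp ↦ (hp T).isPlot⟩

/-- The space `𝓓'(ℝ)` of distributions carries the diffeology induced from the functional diffeology
on the space of smooth maps `𝓓(ℝ) → ℝ`. -/
instance distributionDiffeology : DiffeologicalSpace 𝓓'((⊤ : TopologicalSpace.Opens ℝ), ℝ) :=
  inducedDiffeology distributionToSmoothMap

/-- The density `s ↦ e^(-s²/4t) / √(4πt)`. -/
def heatDensity (t s : ℝ) : ℝ :=
  Real.exp (-s ^ 2 / (4 * t)) / √(4 * Real.pi * t)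

lemma continuous_heatDensity (t : ℝ) : Continuous (heatDensity t) := by
  unfold heatDensity
  fun_prop

/-- The distribution `φ ↦ ∫ f(s) φ(s) ds` with continuous density `f`. -/
def distributionOfDensity (f : ℝ → ℝ) (hf : Continuous f) :
    𝓓'((⊤ : TopologicalSpace.Opens ℝ), ℝ) :=
  TestFunction.mkCLM ℝ (fun φ ↦ ∫ s, f s * φ s)
    (fun φ ψ ↦ by
      have h (χ : 𝓓((⊤ : TopologicalSpace.Opens ℝ), ℝ)) : Integrable (fun s ↦ f s * χ s) :=
        (hf.mul χ.continuous).integrable_of_hasCompactSupport χ.hasCompactSupport.mul_left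
      simp [mul_add, integral_add (h φ) (h ψ)])
    (fun c φ ↦ by
      simp only [smul_apply, smul_eq_mul, mul_left_comm, integral_const_mul])
    (fun K hK ↦ by
      have h := (ContDiffMapSupportedIn.integralAgainstBilinCLM (n := ⊤) (K := K)
        (ContinuousLinearMap.mul ℝ ℝ) volume f).continuous
      refine h.congr fun φ ↦ ?_
      rw [ContDiffMapSupportedIn.integralAgainstBilinCLM_eq_integral
        (hf.continuousOn.integrableOn_compact K.isCompact)]
      simp [mul_comm])

open Classical in
/-- The heat kernel `K : ℝ≥0 → 𝓓'(ℝ)`: for `t > 0` the distribution with density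
`e^(-s²/4t) / √(4πt)`, and for `t = 0` the Dirac distribution at `0`. -/
def heatKernel (t : ℝ≥0) : 𝓓'((⊤ : TopologicalSpace.Opens ℝ), ℝ) :=
  if 0 < t then distributionOfDensity (heatDensity t) (continuous_heatDensity t)
  else Distribution.delta 0

/-- The heat kernel on a test function. -/
lemma heatKernel_apply (t : ℝ≥0) (φ : 𝓓((⊤ : TopologicalSpace.Opens ℝ), ℝ)) :
    heatKernel t φ =
      if 0 < t then ∫ s : ℝ, Real.exp (-s ^ 2 / (4 * (t : ℝ))) / √(4 * Real.pi * (t : ℝ)) * φ s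
      else φ 0 := by
  unfold heatKernel
  split_ifs
  · rfl
  · rfl

end HeatDiffeology

end

/-!
The pairing `⟨K(τ v), Φ v⟩` is smooth because it is the evaluation of a smooth map into a dual
Banach space at a `C^j` curve of vectors, for every `j`. For each `n`, let `S` be the space of test
functions normed by the suprema of the derivatives of order less than `n` (`JetSpace n`), and let
`B = S*`, a Banach space although `S` is not complete. Elements of `B` are distributions.

* A plot `Φ` of test functions gives the map `v ↦ (T ↦ T (Φ v))` into `B*`, which is smooth when
  evaluated at any single `T ∈ B`. Such a map into the dual of a Banach space is smooth for the norm
  (`contDiff_of_forall_apply_contDiff`): by the Banach–Steinhaus theorem it is locally Lipschitz,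
  and so is its weak derivative, which is therefore the derivative in norm.
* The curve `t ↦ K(t)` is of class `C^j` on `[0, ∞)` as a curve in `B`, if `n ≥ 2 j + 4`
  (`contDiffOn_jetHeat`), with derivative `φ ↦ ⟨K(t), φ''⟩`. As `K(t)` is the Gaussian law of
  variance `2 t`, including `t = 0`, the semigroup property and a Taylor expansion of `φ` at order
  two give
  `|⟨K(t), φ⟩ - ⟨K(s), φ⟩ - (t - s) ⟨K(s), φ''⟩| ≤ C |t - s| ^ (3 / 2) sup |φ'''|`
  for all `s, t ≥ 0` (`abs_heatMean_sub_sub_le`), with no singularity at the boundary point `0`.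

Composing the curve with `τ ≥ 0` and evaluating the map into `B*` at the result shows that
`v ↦ ⟨K(τ v), Φ v⟩` is of class `C^j`, for every `j`.
-/

namespace HeatDiffeology

open Metric

/-! ### Pointwise smooth families of operators on a Banach space -/

section WeakStar

variable {E B G : Type} [NormedAddCommGroup E] [NormedSpace ℝ E]
  [NormedAddCommGroup B] [NormedSpace ℝ B]
  [NormedAddCommGroup G] [NormedSpace ℝ G]

/-- The pointwise derivative `f'` is the derivative for the operator norm as soon as it is
continuous: the mean value inequality for `f · b` is uniform in `b` in the unit ball. -/
theorem hasFDerivAt_flip_of_apply_eq_fderiv {f : E → B →L[ℝ] G}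
    (hf : ∀ b, ContDiff ℝ 1 fun v ↦ f v b) {f' : E → B →L[ℝ] E →L[ℝ] G}
    (hf' : ∀ v b, f' v b = fderiv ℝ (fun w ↦ f w b) v) (hcont : Continuous f') (v : E) :
    HasFDerivAt f (f' v).flip v := by
  rw [hasFDerivAt_iff_isLittleO, Asymptotics.isLittleO_iff]
  intro ε hε
  obtain ⟨δ, hδ, h⟩ := Metric.eventually_nhds_iff_ball.1
    ((hcont.tendsto v).eventually (ball_mem_nhds (f' v) hε))
  filter_upwards [ball_mem_nhds v hδ] with w hw
  refine ContinuousLinearMap.opNorm_le_bound _ (by positivity) fun b ↦ ?_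
  have := (convex_ball v δ).norm_image_sub_le_of_norm_fderiv_le' (f := fun w ↦ f w b)
    (φ := f' v b) (C := ε * ‖b‖) (fun x _ ↦ (hf b).differentiable one_ne_zero x)
    (fun x hx ↦ ?_) (mem_ball_self hδ) hw
  · calc _ ≤ ε * ‖b‖ * ‖w - v‖ := this
      _ = _ := by ring
  · rw [← hf' x b, ← sub_apply]
    refine (ContinuousLinearMap.le_opNorm _ _).trans ?_
    gcongr
    rw [← dist_eq_norm]
    exact (h x hx).le

variable [FiniteDimensional ℝ E] [CompleteSpace B]

/-- The difference quotients of `f` on a ball are pointwise bounded, so the Banach–Steinhaus theorem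
bounds them in norm. -/
theorem exists_norm_sub_le_of_forall_apply_contDiff {f : E → B →L[ℝ] G}
    (hf : ∀ b, ContDiff ℝ 1 fun v ↦ f v b) (v : E) :
    ∃ C, 0 ≤ C ∧ ∀ x ∈ ball v 1, ∀ y ∈ ball v 1, ‖f x - f y‖ ≤ C * ‖x - y‖ := by
  let g : (ball v 1 ×ˢ ball v 1 : Set (E × E)) → B →L[ℝ] G :=
    fun p ↦ ‖p.1.1 - p.1.2‖⁻¹ • (f p.1.1 - f p.1.2)
  obtain ⟨C, hC⟩ : ∃ C, ∀ p, ‖g p‖ ≤ C := by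
    refine banach_steinhaus fun b ↦ ?_
    obtain ⟨C, hC⟩ := (isCompact_closedBall v 1).exists_bound_of_continuousOn
      ((hf b).continuous_fderiv one_ne_zero).continuousOn
    refine ⟨C, fun ⟨⟨x, y⟩, hx, hy⟩ ↦ ?_⟩
    have h := (convex_closedBall v 1).norm_image_sub_le_of_norm_fderiv_le
      (fun z _ ↦ (hf b).differentiable one_ne_zero z) hC (ball_subset_closedBall hy)
      (ball_subset_closedBall hx)
    rcases eq_or_ne x y with rfl | hxy
    · simpa [g] using (norm_nonneg _).trans (hC v (mem_closedBall_self zero_le_one))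
    · simp only [g, smul_apply, sub_apply, norm_smul, norm_inv, norm_norm]
      rwa [inv_mul_le_iff₀ (norm_pos_iff.2 (sub_ne_zero.2 hxy)), mul_comm]
  refine ⟨max C 0, le_max_right _ _, fun x hx y hy ↦ ?_⟩
  rcases eq_or_ne x y with rfl | hxy
  · simp
  · have h := (hC ⟨(x, y), hx, hy⟩).trans (le_max_left C 0)
    simp only [g, norm_smul, norm_inv, norm_norm] at h
    rwa [inv_mul_le_iff₀ (norm_pos_iff.2 (sub_ne_zero.2 hxy)), mul_comm] at h

theorem continuous_of_forall_apply_contDiff {f : E → B →L[ℝ] G}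
    (hf : ∀ b, ContDiff ℝ 1 fun v ↦ f v b) : Continuous f := by
  refine continuous_iff_continuousAt.2 fun v ↦ ?_
  obtain ⟨C, -, hC⟩ := exists_norm_sub_le_of_forall_apply_contDiff hf v
  refine continuousAt_of_locally_lipschitz one_pos C fun y hy ↦ ?_
  simpa only [dist_eq_norm] using hC y hy v (mem_ball_self one_pos)

/-- The pointwise derivative of `f` depends continuously on `b`, since `f` is locally Lipschitz. -/
theorem exists_apply_eq_fderiv {f : E → B →L[ℝ] G}
    (hf : ∀ b, ContDiff ℝ 1 fun v ↦ f v b) :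
    ∃ f' : E → B →L[ℝ] E →L[ℝ] G, ∀ v b, f' v b = fderiv ℝ (fun w ↦ f w b) v := by
  have hd (b : B) (v : E) : DifferentiableAt ℝ (fun w ↦ f w b) v :=
    (hf b).differentiable one_ne_zero v
  choose C hC₀ hC using exists_norm_sub_le_of_forall_apply_contDiff hf
  refine ⟨fun v ↦ LinearMap.mkContinuous
    { toFun := fun b ↦ fderiv ℝ (fun w ↦ f w b) v
      map_add' := fun a b ↦ by
        simpa only [map_add] using fderiv_fun_add (hd a v) (hd b v)
      map_smul' := fun c b ↦ by
        simpa only [map_smul, RingHom.id_apply] using fderiv_fun_const_smul (hd b v) c } (C v)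
    fun b ↦ ?_, fun v b ↦ rfl⟩
  refine norm_fderiv_le_of_lip' ℝ (mul_nonneg (hC₀ v) (norm_nonneg b)) ?_
  filter_upwards [ball_mem_nhds v one_pos] with x hx
  calc ‖f x b - f v b‖ = ‖(f x - f v) b‖ := rfl
    _ ≤ ‖f x - f v‖ * ‖b‖ := ContinuousLinearMap.le_opNorm _ _
    _ ≤ C v * ‖x - v‖ * ‖b‖ := by
      gcongr
      exact hC v x hx v (mem_ball_self one_pos)
    _ = C v * ‖b‖ * ‖x - v‖ := by ring

/-- A map into the space of operators on a Banach space is smooth for the operator norm if all its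
evaluations are smooth. For `G = ℝ`: weak-* smooth maps into a dual Banach space are smooth. -/
theorem contDiff_of_forall_apply_contDiff {f : E → B →L[ℝ] G}
    (hf : ∀ b, ContDiff ℝ ∞ fun v ↦ f v b) : ContDiff ℝ ∞ f := by
  refine contDiff_infty.2 fun n ↦ ?_
  -- `G` varies in the induction: the flipped derivative takes values in operators into `E →L[ℝ] G`.
  induction n generalizing G with
  | zero =>
    exact contDiff_zero.2 (continuous_of_forall_apply_contDiff fun b ↦ (hf b).of_le (by simp))
  | succ n ih =>
    have hf₁ (b : B) : ContDiff ℝ 1 fun v ↦ f v b := (hf b).of_le (by simp)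
    obtain ⟨f', hf'⟩ := exists_apply_eq_fderiv hf₁
    have hs (b : B) : ContDiff ℝ ∞ fun v ↦ f' v b := by
      simp only [hf']
      exact (hf b).fderiv_right (by simp)
    refine contDiff_succ_iff_hasFDerivAt.2 ⟨fun v ↦ (f' v).flip, ?_, fun v ↦
      hasFDerivAt_flip_of_apply_eq_fderiv hf₁ hf' (continuous_of_forall_apply_contDiff
        fun b ↦ (hs b).of_le (by simp)) v⟩
    exact (LinearIsometryEquiv.contDiff (𝕜 := ℝ) (E := B →L[ℝ] E →L[ℝ] G)
      (F := E →L[ℝ] B →L[ℝ] G) (ContinuousLinearMap.flipₗᵢ ℝ B E G)).comp (ih hs)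

end WeakStar

open ProbabilityTheory BoundedContinuousFunction

/-! ### A Taylor estimate on the line -/

theorem abs_taylor_two_sub_le {f f₁ f₂ f₃ : ℝ → ℝ} (h₀ : ∀ x, HasDerivAt f (f₁ x) x)
    (h₁ : ∀ x, HasDerivAt f₁ (f₂ x) x) (h₂ : ∀ x, HasDerivAt f₂ (f₃ x) x) {M : ℝ}
    (hM : ∀ x, |f₃ x| ≤ M) (x y : ℝ) :
    |f (x + y) - (f x + y * f₁ x + y ^ 2 / 2 * f₂ x)| ≤ M * |y| ^ 3 := by
  have mvt {g g' : ℝ → ℝ} (hg : ∀ u, HasDerivAt g (g' u) u) {C : ℝ}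
      (hC : ∀ u ∈ closedBall x |y|, |g' u| ≤ C) (hx : g x = 0) :
      ∀ u ∈ closedBall x |y|, |g u| ≤ C * |y| := fun u hu ↦ by
    have h := (convex_closedBall x |y|).norm_image_sub_le_of_norm_hasDerivWithin_le
      (fun z _ ↦ (hg z).hasDerivWithinAt) hC (mem_closedBall_self (abs_nonneg y)) hu
    rw [hx, sub_zero] at h
    refine h.trans (mul_le_mul_of_nonneg_left (mem_closedBall_iff_norm.1 hu) ?_)
    exact (abs_nonneg _).trans (hC u hu)
  -- The remainders of `f₂`, `f₁` and `f` are bounded in turn, each being a primitive of the former.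
  have e₂ := mvt (g := fun u ↦ f₂ u - f₂ x) (g' := f₃) (fun u ↦ (h₂ u).sub_const _)
    (fun u _ ↦ hM u) (sub_self _)
  have e₁ := mvt (g := fun u ↦ f₁ u - f₁ x - (u - x) * f₂ x) (g' := fun u ↦ f₂ u - f₂ x)
    (fun u ↦ by
      convert! ((h₁ u).sub_const (f₁ x)).sub
        (((hasDerivAt_id u).sub_const x).mul_const (f₂ x)) using 1
      simp)
    e₂ (by simp)
  have e₀ := mvt (g := fun u ↦ f u - f x - (u - x) * f₁ x - (u - x) ^ 2 / 2 * f₂ x)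
    (g' := fun u ↦ f₁ u - f₁ x - (u - x) * f₂ x)
    (fun u ↦ by
      convert! (((h₀ u).sub_const (f x)).sub
        (((hasDerivAt_id u).sub_const x).mul_const (f₁ x))).sub
        (((((hasDerivAt_id u).sub_const x).pow 2).div_const 2).mul_const (f₂ x)) using 1
      simp)
    e₁ (by simp)
  convert e₀ (x + y) (by simp [Real.norm_eq_abs]) using 1
  · congr 1; ring
  · ring

/-! ### Gaussian means and the heat semigroup -/

/-- The mean of a bounded continuous function under the centred Gaussian law of variance `2 * t`,
which is the value of the heat semigroup at time `t` and at the origin. At `t = 0` the law is the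
Dirac measure, so that no case distinction is needed. -/
noncomputable def heatMean (t : ℝ≥0) : (ℝ →ᵇ ℝ) →L[ℝ] ℝ :=
  LinearMap.mkContinuous
    { toFun := fun f ↦ ∫ x, f x ∂gaussianReal 0 (2 * t)
      map_add' := fun f g ↦ integral_add (f.integrable _) (g.integrable _)
      map_smul' := fun c f ↦ integral_const_mul c _ } 1
    fun f ↦ by simpa using f.norm_integral_le_norm (gaussianReal 0 (2 * t))

theorem heatMean_apply (t : ℝ≥0) (f : ℝ →ᵇ ℝ) :
    heatMean t f = ∫ x, f x ∂gaussianReal 0 (2 * t) := rfl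

theorem integral_gaussianReal_two_mul (h : ℝ≥0) {g : ℝ → ℝ} (hg : Continuous g) :
    ∫ y, g y ∂gaussianReal 0 (2 * h) = ∫ z, g (√(2 * h) * z) ∂gaussianReal 0 1 := by
  have : gaussianReal 0 (2 * h) = (gaussianReal 0 1).map (√(2 * h) * ·) := by
    rw [gaussianReal_map_const_mul, mul_zero, mul_one]
    congr 1
    ext
    simp only [NNReal.coe_mul, NNReal.coe_ofNat, NNReal.coe_mk]
    exact (Real.sq_sqrt (by positivity)).symm
  rw [this, integral_map (by fun_prop) hg.aestronglyMeasurable]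

/-- The semigroup property: Gaussian laws convolve by adding their variances. -/
theorem heatMean_add_apply (s h : ℝ≥0) (f : ℝ →ᵇ ℝ) :
    heatMean (s + h) f =
      ∫ x, ∫ y, f (x + y) ∂gaussianReal 0 (2 * h) ∂gaussianReal 0 (2 * s) := by
  rw [heatMean_apply, show gaussianReal 0 (2 * (s + h)) =
    Measure.conv (gaussianReal 0 (2 * s)) (gaussianReal 0 (2 * h)) by
      rw [gaussianReal_conv_gaussianReal, mul_add, add_zero], Measure.conv,
    integral_map (by fun_prop) f.continuous.aestronglyMeasurable]
  exact integral_prod (fun p : ℝ × ℝ ↦ f (p.1 + p.2))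
    ((f.compContinuous ⟨fun p : ℝ × ℝ ↦ p.1 + p.2, by fun_prop⟩).integrable _)

/-- A uniform short-time comparison between the mean of `f` around `x` and `g x` propagates to an
arbitrary initial time. -/
theorem abs_heatMean_add_sub_le {s h : ℝ≥0} {f g : ℝ →ᵇ ℝ} {ε : ℝ}
    (hε : ∀ x, |∫ y, f (x + y) ∂gaussianReal 0 (2 * h) - g x| ≤ ε) :
    |heatMean (s + h) f - heatMean s g| ≤ ε := by
  have hint : Integrable (fun x ↦ ∫ y, f (x + y) ∂gaussianReal 0 (2 * h))
      (gaussianReal 0 (2 * s)) :=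
    ((f.compContinuous ⟨fun p : ℝ × ℝ ↦ p.1 + p.2, by fun_prop⟩).integrable
      ((gaussianReal 0 (2 * s)).prod (gaussianReal 0 (2 * h)))).integral_prod_left
  rw [heatMean_add_apply, heatMean_apply, ← integral_sub hint (g.integrable _)]
  refine (norm_integral_le_of_norm_le_const (μ := gaussianReal 0 (2 * s)) (C := ε)
    (Filter.Eventually.of_forall fun x ↦ (Real.norm_eq_abs _).trans_le (hε x))).trans_eq ?_
  simp

theorem integrable_abs_pow_gaussianReal (n : ℕ) :
    Integrable (fun z ↦ |z| ^ n) (gaussianReal 0 1) :=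
  (memLp_id_gaussianReal (n : ℝ≥0)).integrable_norm_pow'

/-- The second-order Taylor expansion of `f` averaged over a Gaussian law: the linear term vanishes,
and the quadratic one contributes `h * f₂ x`. -/
theorem abs_integral_sub_le_of_taylor_two {f f₂ : ℝ →ᵇ ℝ} {f₁ f₃ : ℝ → ℝ}
    (h₀ : ∀ x, HasDerivAt f (f₁ x) x) (h₁ : ∀ x, HasDerivAt f₁ (f₂ x) x)
    (h₂ : ∀ x, HasDerivAt f₂ (f₃ x) x) {M : ℝ} (hM : ∀ x, |f₃ x| ≤ M) (h : ℝ≥0) (x : ℝ) :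
    |∫ y, f (x + y) ∂gaussianReal 0 (2 * h) - (f x + h * f₂ x)| ≤
      M * √(2 * h) ^ 3 * ∫ z, |z| ^ 3 ∂gaussianReal 0 1 := by
  set a := √(2 * h) with ha
  have ha2 : a ^ 2 = 2 * h := Real.sq_sqrt (by positivity)
  have i₁ : Integrable (fun z : ℝ ↦ z) (gaussianReal 0 1) :=
    (memLp_id_gaussianReal 1).integrable le_rfl
  have i₂ : Integrable (fun z : ℝ ↦ z ^ 2) (gaussianReal 0 1) := by
    simpa using integrable_abs_pow_gaussianReal 2
  have v₂ : ∫ z, z ^ 2 ∂gaussianReal 0 1 = 1 := by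
    have := variance_fun_id_gaussianReal (μ := 0) (v := 1)
    rw [variance_eq_integral (by fun_prop)] at this
    simpa [integral_id_gaussianReal] using this
  have key : f x + h * f₂ x =
      ∫ z, (f x + a * z * f₁ x + (a * z) ^ 2 / 2 * f₂ x) ∂gaussianReal 0 1 := by
    have : (fun z ↦ f x + a * z * f₁ x + (a * z) ^ 2 / 2 * f₂ x) =
        fun z ↦ f x + z * (a * f₁ x) + z ^ 2 * (h * f₂ x) := by
      ext z
      rw [mul_pow, ha2]
      ring
    rw [this, integral_add (f := fun z ↦ f x + z * (a * f₁ x))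
        ((integrable_const _).add (i₁.mul_const _)) (i₂.mul_const _),
      integral_add (integrable_const _) (i₁.mul_const _), integral_mul_const, integral_mul_const,
      integral_id_gaussianReal, v₂]
    simp
  rw [integral_gaussianReal_two_mul h (g := fun y ↦ f (x + y)) (by fun_prop), ← ha, key,
    ← integral_sub, ← integral_const_mul, ← Real.norm_eq_abs]
  · refine norm_integral_le_of_norm_le ((integrable_abs_pow_gaussianReal 3).const_mul _)
      (Filter.Eventually.of_forall fun z ↦ ?_)
    refine (abs_taylor_two_sub_le h₀ h₁ h₂ hM x (a * z)).trans_eq ?_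
    rw [abs_mul, abs_of_nonneg (Real.sqrt_nonneg _)]
    ring
  · exact (f.compContinuous ⟨fun z : ℝ ↦ x + a * z, by fun_prop⟩).integrable _
  · refine ((integrable_const _).add ((i₁.const_mul a).mul_const _)).add
      (Integrable.mul_const (Integrable.div_const ?_ _) _)
    simpa only [mul_pow] using i₂.const_mul (a ^ 2)

theorem abs_integral_sub_le_of_deriv_bound {f : ℝ →ᵇ ℝ} {f₁ : ℝ → ℝ}
    (h₀ : ∀ x, HasDerivAt f (f₁ x) x) {M : ℝ} (hM : ∀ x, |f₁ x| ≤ M) (h : ℝ≥0) (x : ℝ) :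
    |∫ y, f (x + y) ∂gaussianReal 0 (2 * h) - f x| ≤
      M * √(2 * h) * ∫ z, |z| ∂gaussianReal 0 1 := by
  have i₁ : Integrable (fun z : ℝ ↦ |z|) (gaussianReal 0 1) := by
    simpa using integrable_abs_pow_gaussianReal 1
  have key : f x = ∫ _, f x ∂gaussianReal 0 1 := by simp
  rw [integral_gaussianReal_two_mul h (g := fun y ↦ f (x + y)) (by fun_prop), key,
    ← integral_sub, ← integral_const_mul, ← Real.norm_eq_abs]
  · refine norm_integral_le_of_norm_le (i₁.const_mul _) (Filter.Eventually.of_forall fun z ↦ ?_)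
    have := (convex_univ (𝕜 := ℝ) (E := ℝ)).norm_image_sub_le_of_norm_hasDerivWithin_le
      (fun z _ ↦ (h₀ z).hasDerivWithinAt) (fun z _ ↦ hM z) (Set.mem_univ x)
      (Set.mem_univ (x + √(2 * h) * z))
    refine this.trans_eq ?_
    rw [add_sub_cancel_left, Real.norm_eq_abs, abs_mul, abs_of_nonneg (Real.sqrt_nonneg _)]
    ring
  · exact (f.compContinuous ⟨fun z : ℝ ↦ x + √(2 * h) * z, by fun_prop⟩).integrable _
  · exact integrable_const _

/-- The constant of `abs_heatMean_sub_sub_le`, in terms of absolute moments of the standard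
Gaussian law. -/
noncomputable def heatConst : ℝ :=
  2 * (∫ z, |z| ^ 3 ∂gaussianReal 0 1) + ∫ z, |z| ∂gaussianReal 0 1

/-- The heat equation `d/dt ⟨K(t), f⟩ = ⟨K(t), f''⟩` in quantitative form, up to the boundary
`t = 0`. The bound is uniform in `f` given a bound `M` of the third derivative. -/
theorem abs_heatMean_sub_sub_le {f f₂ : ℝ →ᵇ ℝ} {f₁ f₃ : ℝ → ℝ}
    (h₀ : ∀ x, HasDerivAt f (f₁ x) x) (h₁ : ∀ x, HasDerivAt f₁ (f₂ x) x)
    (h₂ : ∀ x, HasDerivAt f₂ (f₃ x) x) {M : ℝ} (hM : ∀ x, |f₃ x| ≤ M) (s t : ℝ≥0) :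
    |heatMean t f - heatMean s f - ((t : ℝ) - s) * heatMean s f₂| ≤
      heatConst * M * |(t : ℝ) - s| * √(2 * |(t : ℝ) - s|) := by
  have hM₀ : 0 ≤ M := (abs_nonneg _).trans (hM 0)
  have c₁ : 0 ≤ ∫ z, |z| ∂gaussianReal 0 1 := integral_nonneg fun _ ↦ abs_nonneg _
  have fwd (s h : ℝ≥0) : |heatMean (s + h) f - heatMean s f - h * heatMean s f₂| ≤
      2 * (∫ z, |z| ^ 3 ∂gaussianReal 0 1) * M * h * √(2 * h) := by
    have := abs_heatMean_add_sub_le (s := s) (g := f + (h : ℝ) • f₂)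
      (abs_integral_sub_le_of_taylor_two h₀ h₁ h₂ hM h)
    rw [map_add, map_smul, smul_eq_mul, ← sub_sub] at this
    refine this.trans_eq ?_
    rw [pow_succ, Real.sq_sqrt (by positivity)]
    ring
  rcases le_total s t with hst | hst
  · obtain ⟨h, rfl⟩ := exists_add_of_le hst
    simp only [NNReal.coe_add, add_sub_cancel_left, NNReal.abs_eq]
    refine (fwd s h).trans ?_
    gcongr
    exact le_add_of_nonneg_right c₁
  · obtain ⟨h, rfl⟩ := exists_add_of_le hst
    -- Expanding forwards from the smaller time `t` leaves the change of `⟨K, f₂⟩` between the times.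
    have lip := abs_heatMean_add_sub_le (s := t) (abs_integral_sub_le_of_deriv_bound h₂ hM h)
    have e : (t : ℝ) - ↑(t + h) = -h := by push_cast; ring
    rw [e, abs_neg, NNReal.abs_eq]
    calc |heatMean t f - heatMean (t + h) f - -h * heatMean (t + h) f₂|
        = |-(heatMean (t + h) f - heatMean t f - h * heatMean t f₂) +
            h * (heatMean (t + h) f₂ - heatMean t f₂)| := by congr 1; ring
      _ ≤ |heatMean (t + h) f - heatMean t f - h * heatMean t f₂| +
            h * |heatMean (t + h) f₂ - heatMean t f₂| := by
          refine (abs_add_le _ _).trans_eq ?_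
          rw [abs_neg, abs_mul, NNReal.abs_eq]
      _ ≤ 2 * (∫ z, |z| ^ 3 ∂gaussianReal 0 1) * M * h * √(2 * h) +
            h * (M * √(2 * h) * ∫ z, |z| ∂gaussianReal 0 1) :=
          add_le_add (fwd t h) (mul_le_mul_of_nonneg_left lip h.2)
      _ = heatConst * M * h * √(2 * h) := by rw [heatConst]; ring

/-! ### Jets of test functions, and the heat kernel as a curve in their dual -/

/-- The derivative of test functions on the line, as a continuous linear map. -/
noncomputable def testDeriv : 𝓓((⊤ : TopologicalSpace.Opens ℝ), ℝ) →L[ℝ]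
    𝓓((⊤ : TopologicalSpace.Opens ℝ), ℝ) :=
  TestFunction.lineDerivCLM ℝ 1

theorem hasDerivAt_testDeriv (φ : 𝓓((⊤ : TopologicalSpace.Opens ℝ), ℝ)) (x : ℝ) :
    HasDerivAt φ (testDeriv φ x) x := by
  have h : testDeriv φ x = deriv φ x := by
    rw [testDeriv, TestFunction.lineDerivCLM_apply_of_le (by simp),
      (φ.contDiff.differentiable (by simp)).differentiableAt.lineDeriv_eq_fderiv,
      fderiv_apply_one_eq_deriv]
  rw [h]
  exact (φ.contDiff.differentiable (by simp) x).hasDerivAt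

/-- The derivatives of order less than `n` of a test function, as bounded continuous functions. -/
noncomputable def jet (n : ℕ) :
    𝓓((⊤ : TopologicalSpace.Opens ℝ), ℝ) →L[ℝ] (Fin n → ℝ →ᵇ ℝ) :=
  ContinuousLinearMap.pi fun k ↦
    TestFunction.toBoundedContinuousFunctionCLM ℝ ∘L testDeriv ^ (k : ℕ)

/-- The space of the families of derivatives of order less than `n` of test functions, with the
supremum norm. It is a type of its own, rather than a coerced submodule, so that instance search
finds the norm of its dual. -/
def JetSpace (n : ℕ) : Type := (jet n).range

noncomputable instance (n : ℕ) : NormedAddCommGroup (JetSpace n) :=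
  inferInstanceAs (NormedAddCommGroup (jet n).range)

noncomputable instance (n : ℕ) : NormedSpace ℝ (JetSpace n) :=
  inferInstanceAs (NormedSpace ℝ (jet n).range)

/-- The inclusion of the space of jets of test functions into the space of all families of bounded
continuous functions. -/
def JetSpace.incl (n : ℕ) : JetSpace n →L[ℝ] (Fin n → ℝ →ᵇ ℝ) where
  toFun := Subtype.val
  map_add' _ _ := rfl
  map_smul' _ _ := rfl
  cont := continuous_subtype_val

/-- The jet of a test function, as an element of `JetSpace n`. Composition with it turns continuous
linear functionals on `JetSpace n` into distributions. -/
noncomputable def JetSpace.mk (n : ℕ) :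
    𝓓((⊤ : TopologicalSpace.Opens ℝ), ℝ) →L[ℝ] JetSpace n where
  toFun φ := ⟨jet n φ, φ, rfl⟩
  map_add' φ ψ := Subtype.ext (map_add (jet n) φ ψ)
  map_smul' c φ := Subtype.ext (map_smul (jet n) c φ)
  cont := (jet n).continuous.subtype_mk _

theorem hasDerivAt_jet {n k : ℕ} (hk : k + 1 < n) (φ : 𝓓((⊤ : TopologicalSpace.Opens ℝ), ℝ))
    (x : ℝ) :
    HasDerivAt (jet n φ ⟨k, k.lt_succ_self.trans hk⟩) (jet n φ ⟨k + 1, hk⟩ x) x := by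
  have := hasDerivAt_testDeriv ((testDeriv ^ k) φ) x
  rwa [← mul_apply_eq_comp, ← pow_succ'] at this

/-- The functional `φ ↦ ⟨K(t), φ⁽ᵏ⁾⟩` on the space of jets of test functions. It is a function of
real `t`, constant for `t ≤ 0`, so that it can be differentiated on `[0, ∞)`. -/
noncomputable def jetHeat {n : ℕ} (k : Fin n) (t : ℝ) : StrongDual ℝ (JetSpace n) :=
  heatMean t.toNNReal ∘L ContinuousLinearMap.proj k ∘L JetSpace.incl n

theorem norm_jetHeat_sub_sub_le {n k : ℕ} (hk : k + 3 < n) {s t : ℝ} (hs : 0 ≤ s) (ht : 0 ≤ t) :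
    ‖jetHeat (n := n) ⟨k, by omega⟩ t - jetHeat (n := n) ⟨k, by omega⟩ s -
      (t - s) • jetHeat (n := n) ⟨k + 2, by omega⟩ s‖ ≤
      heatConst * |t - s| * √(2 * |t - s|) := by
  have hc : 0 ≤ heatConst := by
    unfold heatConst
    positivity
  refine ContinuousLinearMap.opNorm_le_bound _ (by positivity) ?_
  rintro ⟨_, φ, rfl⟩
  have := abs_heatMean_sub_sub_le (hasDerivAt_jet (n := n) (k := k) (by omega) φ)
    (hasDerivAt_jet (k := k + 1) (by omega) φ) (hasDerivAt_jet (k := k + 2) (by omega) φ)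
    (M := ‖jet n φ‖) (fun x ↦ (norm_coe_le_norm (jet n φ ⟨k + 3, hk⟩) x).trans
      (norm_le_pi_norm (jet n φ) _))
    s.toNNReal t.toNNReal
  rw [Real.coe_toNNReal s hs, Real.coe_toNNReal t ht] at this
  refine this.trans_eq ?_
  change _ = _ * ‖jet n φ‖
  ring

theorem hasDerivWithinAt_jetHeat {n k : ℕ} (hk : k + 3 < n) {s : ℝ} (hs : 0 ≤ s) :
    HasDerivWithinAt (jetHeat (n := n) ⟨k, by omega⟩) (jetHeat (n := n) ⟨k + 2, by omega⟩ s)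
      (Set.Ici 0) s := by
  rw [hasDerivWithinAt_iff_isLittleO]
  have hO : (fun t ↦ jetHeat (n := n) ⟨k, by omega⟩ t - jetHeat (n := n) ⟨k, by omega⟩ s -
      (t - s) • jetHeat (n := n) ⟨k + 2, by omega⟩ s) =O[nhdsWithin s (Set.Ici 0)]
      fun t ↦ (t - s) * √(2 * |t - s|) := by
    refine Asymptotics.IsBigO.of_bound heatConst ?_
    filter_upwards [self_mem_nhdsWithin] with t ht
    refine (norm_jetHeat_sub_sub_le hk hs ht).trans_eq ?_
    rw [norm_mul, Real.norm_eq_abs, Real.norm_of_nonneg (Real.sqrt_nonneg _), mul_assoc]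
  refine hO.trans_isLittleO ?_
  have hlim : (fun t ↦ √(2 * |t - s|)) =o[nhdsWithin s (Set.Ici 0)] fun _ ↦ (1 : ℝ) := by
    refine (Asymptotics.isLittleO_one_iff ℝ).2 (Filter.Tendsto.mono_left ?_ nhdsWithin_le_nhds)
    have : Continuous fun t ↦ √(2 * |t - s|) := by fun_prop
    simpa using this.tendsto s
  simpa using (Asymptotics.isBigO_refl (fun t ↦ t - s) _).mul_isLittleO hlim

theorem contDiffOn_jetHeat {n : ℕ} (j : ℕ) {k : ℕ} (hk : k + 2 * j + 3 < n) :
    ContDiffOn ℝ j (jetHeat (n := n) ⟨k, by omega⟩) (Set.Ici 0) := by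
  induction j generalizing k with
  | zero =>
    exact contDiffOn_zero.2 fun s hs ↦ (hasDerivWithinAt_jetHeat (by omega) hs).continuousWithinAt
  | succ j ih =>
    have hd : ∀ s ∈ Set.Ici (0 : ℝ), HasDerivWithinAt (jetHeat (n := n) ⟨k, by omega⟩)
      (jetHeat (n := n) ⟨k + 2, by omega⟩ s) (Set.Ici 0) s :=
        fun s hs ↦ hasDerivWithinAt_jetHeat (by omega) hs
    refine (contDiffOn_succ_iff_derivWithin (uniqueDiffOn_Ici 0)).2
      ⟨fun s hs ↦ (hd s hs).differentiableWithinAt,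
        fun h ↦ absurd h (WithTop.natCast_ne_top j), ?_⟩
    exact (ih (k := k + 2) (by omega)).congr fun s hs ↦
      (hd s hs).derivWithin (uniqueDiffOn_Ici 0 s hs)

/-! ### The heat kernel along plots -/

theorem heatKernel_apply_eq_heatMean (t : ℝ≥0) (φ : 𝓓((⊤ : TopologicalSpace.Opens ℝ), ℝ)) :
    heatKernel t φ = heatMean t (TestFunction.toBoundedContinuousFunctionCLM ℝ φ) := by
  rw [heatKernel_apply, heatMean_apply]
  split_ifs with ht
  · rw [integral_gaussianReal_eq_integral_smul (by positivity)]
    refine integral_congr_ae (Filter.Eventually.of_forall fun s ↦ ?_)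
    have e₁ : 2 * ((2 : ℝ) * t) = 4 * t := by ring
    have e₂ : 2 * Real.pi * (2 * (t : ℝ)) = 4 * Real.pi * t := by ring
    simp [gaussianPDFReal, e₁, e₂, div_eq_inv_mul]
  · obtain rfl : t = 0 := by simpa using ht
    simp [gaussianReal_zero_var]

/-- The pairing of the heat kernel at a smoothly varying time with a scalarwise smooth family of
test functions is smooth. -/
theorem contDiff_heatKernel_apply {E : Type} [NormedAddCommGroup E] [NormedSpace ℝ E]
    [FiniteDimensional ℝ E] {τ : E → ℝ≥0} (hτ : ContDiff ℝ ∞ fun v ↦ (τ v : ℝ))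
    {Φ : E → 𝓓((⊤ : TopologicalSpace.Opens ℝ), ℝ)}
    (hΦ : ∀ T : 𝓓((⊤ : TopologicalSpace.Opens ℝ), ℝ) →L[ℝ] ℝ, ContDiff ℝ ∞ fun v ↦ T (Φ v)) :
    ContDiff ℝ ∞ fun v ↦ heatKernel (τ v) (Φ v) := by
  refine contDiff_infty.2 fun j ↦ ?_
  let n := 2 * j + 4
  let F (v : E) : StrongDual ℝ (StrongDual ℝ (JetSpace n)) :=
    NormedSpace.inclusionInDoubleDual ℝ (JetSpace n) (JetSpace.mk n (Φ v))
  have hF : ContDiff ℝ ∞ F := contDiff_of_forall_apply_contDiff fun T ↦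
    hΦ (T ∘L JetSpace.mk n)
  have hκ : ContDiff ℝ j fun v ↦ jetHeat (n := n) ⟨0, by omega⟩ (τ v) :=
    (contDiffOn_jetHeat j (by omega)).comp_contDiff (contDiff_infty.1 hτ j) fun v ↦ (τ v).2
  have key (v : E) : heatKernel (τ v) (Φ v) = F v (jetHeat ⟨0, by omega⟩ (τ v)) := by
    rw [heatKernel_apply_eq_heatMean]
    change _ = heatMean (τ v : ℝ).toNNReal (jet n (Φ v) ⟨0, _⟩)
    rw [Real.toNNReal_coe]
    rfl
  simpa only [key] using (contDiff_infty.1 hF j).clm_apply hκ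

end HeatDiffeology

/-- The heat kernel `K : ℝ≥0 → 𝓓'(ℝ)` is smooth in the diffeological sense. -/
theorem theorem4p2 : DSmooth HeatDiffeology.heatKernel := fun _ _ hp _ _ hq ↦
  isPlot_iff_contDiff.2 <| HeatDiffeology.contDiff_heatKernel_apply
    (τ := fun _ ↦ _) (IsPlot.contDiff (X := ℝ) hp |>.comp hq.1.contDiff) hq.2
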